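/- Let $N$ be a finite set of players, let each player $i\in N$ have a finite nonempty set $S_i$ of pure strategies, and put $S=\prod_{i\in N}S_i$ (the set of positions). A normal-form game on $(N,S)$ is given by a payoff matrix $P\colon S\to\mathbb R^N$. A (canonical) misinformation game is a tuple $mG=\langle G^0,(G^i)_{i\in N}\rangle$ of normal-form games on $(N,S)$ with payoff matrices $P^0$, $P^i$; $G^0$ is the actual game and $G^i$ is the game of player $i$. A natural misinformed equilibrium (nme) of $mG$ is a mixed strategy profile $\sigma=(\sigma_i)_{i\in N}$ such that each $\sigma_i$ is the strategy of player $i$ in some Nash equilibrium of $G^i$; $NME(mG)$ is the set of nme's. Put $\chi(\sigma)=\prod_{i}\operatorname{supp}(\sigma_i)\subseteq S$. For $v\in S$, let $mG_v$ be the misinformation game obtained from $mG$ by replacing, in each $P^i$ with $i\in N$, the payoff vector at position $v$ by $P^0(v)$. For a set $M$ of misinformation games put $\mathcal{AD}(M)=\{mG_v : mG\in M,\ \sigma\in NME(mG),\ v\in\chi(\sigma)\}$, let $\mathcal{AD}^{(t)}$ be the $t$-th iterate of $\mathcal{AD}$, and let $\mathcal{AD}^{*}(M)=\bigcup_{t\ge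 0}\mathcal{AD}^{(t)}(M)$. Let $\mathcal{AD}^{\infty}(M)=\mathcal{AD}^{(t)}(M)$ for the smallest $t\ge 0$ with $\mathcal{AD}^{(t+1)}(M)=\mathcal{AD}^{(t)}(M)$. A stable misinformed equilibrium (sme) of $mG$ is a mixed strategy profile $\sigma$ for which there is $\widehat{mG}\in\mathcal{AD}^{\infty}(\{mG\})$ with $\sigma\in NME(\widehat{mG})$ and $\widehat{mG}_v=\widehat{mG}$ for all $v\in\chi(\sigma)$. The terminal set of $mG$ is $\mathcal T=\{mG'\in\mathcal{AD}^{*}(\{mG\}) : mG'\in\mathcal{AD}(\{mG'\})\}$. The adaptation graph $\Gamma$ of $mG$ is the directed graph with vertex set $\mathcal{AD}^{*}(\{mG\})$ and an edge from $mG^1$ to $mG^2$ whenever $mG^2=(mG^1)_v$ for some $\sigma\in NME(mG^1)$ and $v\in\chi(\sigma)$; $\Gamma'$ is $\Gamma$ without its self-loops. Let $K$ be the set of sinks of $\Gamma'$, i.e. of the vertices of out-degree $0$ in $\Gamma'$. Then, for every misinformation game $mG$ as above: 1. $K\subseteq\mathcal T$. 2. For every $mG'\in K$, every nme of $mG'$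 is an sme of $mG$. 3. If $mG'$ is the last node of a maximal path in $\Gamma'$ starting from $mG$ (a path that cannot be extended to a longer one), then $mG'$ has at least one nme, and every nme of $mG'$ is an sme of $mG$. -/

import Mathlib

/-- A normal-form game with player set `ι`, where player `i` has the set `S i` of pure strategies:
at each position (pure strategy profile) `v`, the entry `payoff v` of the payoff matrix is the
vector of the payoffs of all the players. -/
@[ext]
structure NormalFormGame (ι : Type*) (S : ι → Type*) where
  payoff : (∀ i, S i) → ι → ℝ

/-- A misinformation game in which the actual game and the game of every player differ only in
their payoffs. -/
@[ext]
structure MisinformationGame (ι : Type*) (S : ι → Type*) where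
  /-- The actual game. -/
  actual : NormalFormGame ι S
  /-- The game of each player, i.e. her subjective view. -/
  subjective : ι → NormalFormGame ι S

/-- A profile of mixed strategies. -/
abbrev StrategyProfile (ι : Type*) (S : ι → Type*) [∀ i, Fintype (S i)] : Type _ :=
  ∀ i, stdSimplex ℝ (S i)

/-- The characteristic set of `σ`: all positions formed by pure strategies which the
players play with positive probability. -/
def characteristicSet {ι : Type*} {S : ι → Type*} [∀ i, Fintype (S i)]
    (σ : StrategyProfile ι S) : Set (∀ i, S i) :=
  {v | ∀ i, 0 < σ i (v i)}

namespace NormalFormGame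

variable {ι : Type*} {S : ι → Type*} [Fintype ι] [DecidableEq ι] [∀ i, Fintype (S i)]

/-- The expected payoff of player `i` under the mixed strategy profile `σ`. -/
def expectedPayoff (G : NormalFormGame ι S) (σ : StrategyProfile ι S) (i : ι) : ℝ :=
  ∑ s : (∀ j, S j), G.payoff s i * ∏ j, σ j (s j)

/-- The set of (mixed) Nash equilibria. -/
def nashEquilibria (G : NormalFormGame ι S) : Set (StrategyProfile ι S) :=
  {σ | ∀ (i : ι) (τ : stdSimplex ℝ (S i)),
    G.expectedPayoff (Function.update σ i τ) i ≤ G.expectedPayoff σ i}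

end NormalFormGame

namespace MisinformationGame

variable {ι : Type*} {S : ι → Type*} [Fintype ι] [DecidableEq ι]
  [∀ i, Fintype (S i)] [∀ i, DecidableEq (S i)]

/-- The natural misinformed equilibria: the strategy of each player `i` is her strategy
in some Nash equilibrium of her own game. -/
def NME (mG : MisinformationGame ι S) : Set (StrategyProfile ι S) :=
  {σ | ∀ i, ∃ τ ∈ (mG.subjective i).nashEquilibria, τ i = σ i}

/-- The `v`-update of `mG`: in every subjective payoff matrix, the payoff vector at position `v`
is replaced by the actual one. -/
def updateAt (mG : MisinformationGame ι S) (v : ∀ i, S i) : MisinformationGame ι S where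
  actual := mG.actual
  subjective i := ⟨Function.update (mG.subjective i).payoff v (mG.actual.payoff v)⟩

/-- One step of the Adaptation Procedure on a set of misinformation games. The `t`-th iterate of
the procedure is `adapt^[t]`. -/
def adapt (M : Set (MisinformationGame ι S)) : Set (MisinformationGame ι S) :=
  {mG' | ∃ mG ∈ M, ∃ σ ∈ mG.NME, ∃ v ∈ characteristicSet σ, mG' = mG.updateAt v}

/-- All the misinformation games produced by the Adaptation Procedure. -/
def adaptStar (M : Set (MisinformationGame ι S)) : Set (MisinformationGame ι S) :=
  ⋃ t : ℕ, adapt^[t] M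

/-- The Adaptation Procedure on `M` terminates at step `t`. -/
def TerminatesAt (M : Set (MisinformationGame ι S)) (t : ℕ) : Prop :=
  IsLeast {t : ℕ | adapt^[t + 1] M = adapt^[t] M} t

/-- The stable set: the iterate at the step at which the procedure terminates (it has no elements
if the procedure does not terminate). -/
def stableSet (M : Set (MisinformationGame ι S)) : Set (MisinformationGame ι S) :=
  {mG' | ∃ t, TerminatesAt M t ∧ mG' ∈ adapt^[t] M}

/-- The stable misinformed equilibria. -/
def SME (mG : MisinformationGame ι S) : Set (StrategyProfile ι S) :=
  {σ | ∃ mG' ∈ stableSet {mG}, σ ∈ mG'.NME ∧ ∀ v ∈ characteristicSet σ, mG'.updateAt v = mG'}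

/-- The terminal set of the Adaptation Procedure on `mG`. -/
def terminalSet (mG : MisinformationGame ι S) : Set (MisinformationGame ι S) :=
  {mG' ∈ adaptStar {mG} | mG' ∈ adapt {mG'}}

/-- The adaptation graph `Γ`. -/
def adaptationGraph (mG : MisinformationGame ι S) : Digraph (adaptStar {mG}) where
  Adj a b := ∃ σ ∈ a.1.NME, ∃ v ∈ characteristicSet σ, b.1 = a.1.updateAt v

/-- The loopless version `Γ'` of the adaptation graph. -/
def looplessAdaptationGraph (mG : MisinformationGame ι S) : Digraph (adaptStar {mG}) where
  Adj a b := mG.adaptationGraph.Adj a b ∧ a ≠ b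

/-- The root of the adaptation graph. -/
def root (mG : MisinformationGame ι S) : adaptStar {mG} :=
  ⟨mG, Set.mem_iUnion.2 ⟨0, Set.mem_singleton mG⟩⟩

end MisinformationGame

/-- The number of edges of a digraph that leave `a`. -/
noncomputable def Digraph.outDeg {V : Type*} (Γ : Digraph V) (a : V) : ℕ∞ :=
  {b | Γ.Adj a b}.encard

/-- The list `p` of vertices is a path of `Γ` that starts at `r`. -/
def Digraph.IsPathFrom {V : Type*} (Γ : Digraph V) (r : V) (p : List V) : Prop :=
  p.head? = some r ∧ p.IsChain Γ.Adj ∧ p.Nodup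

/-- The list `p` is a path of `Γ` that starts at `r` and cannot be extended to a longer one. -/
def Digraph.IsMaximalPathFrom {V : Type*} (Γ : Digraph V) (r : V) (p : List V) : Prop :=
  Γ.IsPathFrom r p ∧ ∀ q, Γ.IsPathFrom r q → p <+: q → q = p

/-- The sinks of the loopless adaptation graph. -/
def MisinformationGame.sinks {ι : Type*} {S : ι → Type*} [Fintype ι] [DecidableEq ι]
    [∀ i, Fintype (S i)] [∀ i, DecidableEq (S i)] (mG : MisinformationGame ι S) :
    Set (MisinformationGame ι S) :=
  {mG' | ∃ h : mG' ∈ MisinformationGame.adaptStar {mG},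
    mG.looplessAdaptationGraph.outDeg ⟨mG', h⟩ = 0}

/-! Call a position misinformed if some player's payoff vector there differs from the actual one. An
update either changes nothing or removes exactly one misinformed position, so `Γ'` has no cycles and
the procedure becomes stationary. At a sink, every update prompted by an nme is trivial. Nash's
theorem supplies an nme, so a sink reproduces itself, survives in all later iterates and lies in the
stable set; hence its nme's are sme's. A maximal path ends in a sink, since acyclicity lets any
out-neighbour extend it.

Nash's theorem comes from Brouwer's, and Brouwer's from the absence of a `C¹` retraction `f` of a
ball onto its sphere. For small `t > 0`, `x + t (f x - x)` maps the ball bijectively onto itself, so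
its Jacobian integrates to the volume. The integral is polynomial in `t`, so it is the volume at `t
= 1` too; but there the Jacobian vanishes, as `f` takes values in a sphere. -/

/-! ### No continuously differentiable retraction of a ball onto its sphere -/

open scoped NNReal RealInnerProductSpace in
/-- The metric projection onto a nonempty complete convex set is a `1`-Lipschitz retraction. -/
theorem exists_lipschitzWith_one_retraction {E : Type*} [NormedAddCommGroup E]
    [InnerProductSpace ℝ E] {K : Set E} (hne : K.Nonempty) (hK : IsComplete K)
    (hconv : Convex ℝ K) :
    ∃ P : E → E, LipschitzWith 1 P ∧ (∀ x, P x ∈ K) ∧ (∀ x ∈ K, P x = x) ∧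
      ∀ x, ∀ w ∈ K, ⟪x - P x, w - P x⟫ ≤ 0 := by
  choose P hPK hP using exists_norm_eq_iInf_of_complete_convex hne hK hconv
  have hin : ∀ x, ∀ w ∈ K, ⟪x - P x, w - P x⟫ ≤ 0 := fun x ↦
    (norm_eq_iInf_iff_real_inner_le_zero hconv (hPK x)).1 (hP x)
  refine ⟨P, LipschitzWith.of_dist_le_mul fun x y ↦ ?_, hPK, fun x hx ↦ ?_, hin⟩
  · have h1 := hin x (P y) (hPK y)
    have h2 := hin y (P x) (hPK x)
    have h3 : ⟪x - y, P x - P y⟫ ≥ ‖P x - P y‖ ^ 2 := by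
      rw [← real_inner_self_eq_norm_sq]
      simp only [inner_sub_left, inner_sub_right] at *
      linarith
    have h4 := real_inner_le_norm (x - y) (P x - P y)
    rw [dist_eq_norm, dist_eq_norm, NNReal.coe_one, one_mul]
    by_contra! h
    nlinarith [norm_nonneg (x - y), norm_nonneg (P x - P y)]
  · have := hin x x hx
    rw [real_inner_self_nonpos, sub_eq_zero] at this
    exact this.symm

/-- The projection onto a closed ball sends the points outside of the ball to the sphere. -/
theorem exists_lipschitzWith_one_retraction_closedBall {E : Type*} [NormedAddCommGroup E]
    [InnerProductSpace ℝ E] [CompleteSpace E] {R : ℝ} (hR : 0 < R) :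
    ∃ P : E → E, LipschitzWith 1 P ∧ (∀ x, ‖P x‖ ≤ R) ∧ (∀ x, ‖x‖ ≤ R → P x = x) ∧
      ∀ x, R < ‖x‖ → ‖P x‖ = R := by
  obtain ⟨P, hP, hPK, hPid, hin⟩ := exists_lipschitzWith_one_retraction (K := Metric.closedBall 0 R)
    ⟨(0 : E), by simpa using hR.le⟩ Metric.isClosed_closedBall.isComplete (convex_closedBall 0 R)
  simp only [mem_closedBall_zero_iff] at hPK hPid hin
  refine ⟨P, hP, hPK, hPid, fun x hx ↦ (hPK x).antisymm ?_⟩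
  by_contra! h
  have hpos : 0 < ‖x - P x‖ := by
    rw [norm_pos_iff, sub_ne_zero]
    rintro e
    rw [← e] at h
    linarith
  -- Moving from `P x` towards `x` by the distance `R - ‖P x‖` stays in the ball, against the
  -- variational inequality.
  set s := (R - ‖P x‖) / ‖x - P x‖ with hs
  have hs0 : 0 < s := div_pos (by linarith) hpos
  have := hin x (P x + s • (x - P x)) (by
    refine (norm_add_le _ _).trans ?_
    rw [norm_smul, Real.norm_of_nonneg hs0.le, hs, div_mul_cancel₀ _ hpos.ne']
    linarith)
  rw [add_sub_cancel_left, inner_smul_right, real_inner_self_eq_norm_sq] at this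
  have : 0 < s * ‖x - P x‖ ^ 2 := by positivity
  linarith

/-- Extrapolation of the polynomial `t ↦ det (1 + t • A)` from nodes close to `0` to `t = 1`. -/
theorem exists_det_one_add_eq_sum (E : Type*) [AddCommGroup E] [Module ℝ E]
    [FiniteDimensional ℝ E] {ε : ℝ} (hε : 0 < ε) :
    ∃ (m : ℕ) (c t : Fin m → ℝ), (∀ k, 0 < t k ∧ t k < ε) ∧ ∑ k, c k = 1 ∧
      ∀ A : E →ₗ[ℝ] E, LinearMap.det (1 + A) = ∑ k, c k * LinearMap.det (1 + t k • A) := by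
  set n := Module.finrank ℝ E
  -- The determinant has degree at most `n` in `t`, so `n + 1` distinct nodes suffice; the shifts
  -- keep them strictly between `0` and `ε`.
  let t : Fin (n + 1) → ℝ := fun k ↦ ε * ((k + 1 : ℝ) / (n + 2))
  have ht : Set.InjOn t (Finset.univ : Finset (Fin (n + 1))) := by
    intro a _ b _ hab
    have h2 : (n + 2 : ℝ) ≠ 0 := by positivity
    simp only [t] at hab
    field_simp at hab
    exact Fin.ext (by exact_mod_cast add_right_cancel hab)
  refine ⟨n + 1, fun k ↦ (Lagrange.basis Finset.univ t k).eval 1, t, fun k ↦ ⟨by positivity, ?_⟩,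
    ?_, fun A ↦ ?_⟩
  · have : ((k : ℝ) + 1) / (n + 2) < 1 := by
      rw [div_lt_one (by positivity)]
      have : (k : ℝ) < n + 1 := by exact_mod_cast k.2
      linarith
    simp only [t]
    nlinarith
  · rw [← Polynomial.eval_finsetSum, Lagrange.sum_basis ht Finset.univ_nonempty, Polynomial.eval_one]
  · let b := Module.finBasis ℝ E
    let B := LinearMap.toMatrix b b A
    let p : Polynomial ℝ :=
      ((Polynomial.X : Polynomial ℝ) • B.map Polynomial.C + (1 : Matrix _ _ ℝ).map Polynomial.C).det
    have hp : ∀ s : ℝ, p.eval s = LinearMap.det (1 + s • A) := by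
      intro s
      rw [← LinearMap.det_toMatrix b, ← Polynomial.coe_evalRingHom, RingHom.map_det]
      congr 1
      ext i j
      rcases eq_or_ne i j with rfl | hij
      · simp [B, LinearMap.toMatrix_one]
        ring
      · simp [B, LinearMap.toMatrix_one, hij]
        ring
    have hdeg : p.degree < (Finset.univ : Finset (Fin (n + 1))).card := by
      refine Polynomial.degree_le_natDegree.trans_lt ?_
      rw [Finset.card_univ, Fintype.card_fin]
      have := Polynomial.natDegree_det_X_add_C_le B 1
      rw [Fintype.card_fin] at this
      exact_mod_cast Nat.lt_succ_of_le this
    have h1 := congrArg (Polynomial.eval 1) (Lagrange.eq_interpolate ht hdeg)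
    rw [hp, one_smul, Lagrange.interpolate_apply, Polynomial.eval_finsetSum] at h1
    rw [h1]
    exact Finset.sum_congr rfl fun k _ ↦ by simp [hp, mul_comm]

open scoped RealInnerProductSpace in
/-- The differential of a map with values in a sphere is nowhere invertible. -/
theorem det_fderiv_eq_zero_of_norm_eq {E : Type*} [NormedAddCommGroup E] [InnerProductSpace ℝ E]
    [FiniteDimensional ℝ E] {f : E → E} {f' : E →L[ℝ] E} {x : E} {R : ℝ} (hR : 0 < R)
    (hf : HasFDerivAt f f' x) (hnorm : ∀ y, ‖f y‖ = R) : f'.det = 0 := by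
  have h0 : ∀ v, ⟪f x, f' v⟫ = 0 := by
    intro v
    have h1 := hf.norm_sq
    have h2 : (fun y ↦ ‖f y‖ ^ 2) = fun _ ↦ R ^ 2 := by
      funext y
      rw [hnorm]
    rw [h2] at h1
    have h3 := congrArg (fun L : E →L[ℝ] ℝ ↦ L v) (h1.unique (hasFDerivAt_const _ _))
    simpa using h3
  by_contra hdet
  have hsurj : Function.Surjective f' :=
    (LinearMap.equivOfDetNeZero (f' : E →ₗ[ℝ] E) hdet).surjective
  obtain ⟨v, hv⟩ := hsurj (f x)
  have := h0 v
  rw [hv, real_inner_self_eq_norm_sq, hnorm] at this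
  exact hR.ne' (pow_eq_zero_iff two_ne_zero |>.1 this)

/-- A small perturbation of the identity that fixes the sphere maps the ball injectively onto
itself. -/
theorem injOn_and_image_ball_eq_of_perturbation {E : Type*} [NormedAddCommGroup E]
    [InnerProductSpace ℝ E] [CompleteSpace E] {u : E → E} {R : ℝ} (hR : 0 < R) {C : NNReal}
    (hu : LipschitzOnWith C u (Metric.closedBall 0 R)) (husphere : ∀ x, ‖x‖ = R → u x = 0)
    (hbound : ∀ x, ‖x + u x‖ ≤ R) {t : ℝ} (ht : 0 < t) (ht1 : t < 1) (htC : t * C < 1) :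
    Set.InjOn (fun x ↦ x + t • u x) (Metric.ball 0 R) ∧
      (fun x ↦ x + t • u x) '' Metric.ball 0 R = Metric.ball 0 R := by
  obtain ⟨P, hP, hPR, hPid, hPsphere⟩ := exists_lipschitzWith_one_retraction_closedBall (E := E) hR
  have hlip : LipschitzWith C (fun x ↦ u (P x)) := by
    have := hu.comp (hP.lipschitzOnWith (s := Set.univ)) (fun x _ ↦ by simpa using hPR x)
    rwa [mul_one, lipschitzOnWith_univ] at this
  -- Composing `u` with the projection makes the perturbation globally Lipschitz, so `G` is a
  -- bijection of `E`. Outside the ball `G` is the identity, because `P` lands on the sphere, where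
  -- `u` vanishes.
  let G : E → E := fun x ↦ x + t • u (P x)
  have hG : ApproximatesLinearOn G ((ContinuousLinearEquiv.refl ℝ E : E ≃L[ℝ] E) : E →L[ℝ] E)
      Set.univ (t.toNNReal * C) := by
    intro x _ y _
    have : G x - G y - (x - y) = t • (u (P x) - u (P y)) := by
      simp only [G, smul_sub]
      abel
    simp only [ContinuousLinearEquiv.coe_refl, ContinuousLinearMap.id_apply]
    rw [this, norm_smul, Real.norm_of_nonneg ht.le, NNReal.coe_mul, Real.coe_toNNReal _ ht.le,
      mul_assoc]
    exact mul_le_mul_of_nonneg_left (hlip.norm_sub_le x y) ht.le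
  have hc : Subsingleton E ∨ t.toNNReal * C <
      ‖((ContinuousLinearEquiv.refl ℝ E).symm : E →L[ℝ] E)‖₊⁻¹ := by
    rcases subsingleton_or_nontrivial E with h | h
    · exact .inl h
    · right
      have : ‖((ContinuousLinearEquiv.refl ℝ E).symm : E →L[ℝ] E)‖₊ = 1 := by
        simp [ContinuousLinearEquiv.refl_symm]
      rw [this, inv_one, ← NNReal.coe_lt_coe, NNReal.coe_mul, Real.coe_toNNReal _ ht.le]
      simpa using htC
  have hGin : ∀ x, ‖x‖ ≤ R → G x = x + t • u x := fun x hx ↦ by simp only [G, hPid x hx]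
  have hGout : ∀ x, R ≤ ‖x‖ → G x = x := by
    intro x hx
    have : ‖P x‖ = R := by
      rcases hx.eq_or_lt with h | h
      · rw [hPid x h.ge, ← h]
      · exact hPsphere x h
    simp [G, husphere _ this]
  have hinj := hG.injOn hc
  have hsurj := hG.surjective hc
  have hball : ∀ x, ‖x‖ < R → ‖x + t • u x‖ < R := by
    intro x hx
    have : x + t • u x = (1 - t) • x + t • (x + u x) := by
      rw [smul_add, sub_smul, one_smul]
      abel
    rw [this]
    calc _ ≤ ‖(1 - t) • x‖ + ‖t • (x + u x)‖ := norm_add_le _ _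
      _ = (1 - t) * ‖x‖ + t * ‖x + u x‖ := by
        rw [norm_smul, norm_smul, Real.norm_of_nonneg ht.le, Real.norm_of_nonneg (by linarith)]
      _ < R := by nlinarith [hbound x]
  refine ⟨fun x hx y hy hxy ↦ ?_, Set.Subset.antisymm ?_ ?_⟩
  · rw [mem_ball_zero_iff] at hx hy
    refine hinj (Set.mem_univ _) (Set.mem_univ _) ?_
    rw [hGin x hx.le, hGin y hy.le]
    exact hxy
  · rintro _ ⟨x, hx, rfl⟩
    rw [mem_ball_zero_iff] at hx ⊢
    exact hball x hx
  · intro y hy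
    rw [mem_ball_zero_iff] at hy
    obtain ⟨x, rfl⟩ := hsurj y
    have hx : ‖x‖ < R := by
      by_contra! h
      rw [hGout x h] at hy
      linarith
    exact ⟨x, by simpa using hx, (hGin x hx.le).symm⟩

open MeasureTheory in
/-- There is no continuously differentiable retraction of a ball onto its sphere. -/
theorem not_exists_contDiff_retraction_sphere {E : Type*} [NormedAddCommGroup E]
    [InnerProductSpace ℝ E] [FiniteDimensional ℝ E] {f : E → E} {R : ℝ} (hR : 0 < R)
    (hf : ContDiff ℝ 1 f) (hnorm : ∀ x, ‖f x‖ = R) (hid : ∀ x, ‖x‖ = R → f x = x) : False := by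
  borelize E
  let μ : Measure E := Measure.addHaar
  let u : E → E := fun x ↦ f x - x
  have hu : ContDiff ℝ 1 u := hf.sub contDiff_id
  have hu' : Continuous (fderiv ℝ u) := hu.continuous_fderiv one_ne_zero
  have hud : ∀ x, HasFDerivAt u (fderiv ℝ u x) x := fun x ↦
    (hu.differentiable one_ne_zero x).hasFDerivAt
  obtain ⟨C₀, hC₀⟩ := (isCompact_closedBall (0 : E) R).exists_bound_of_continuousOn hu'.continuousOn
  let C : NNReal := C₀.toNNReal
  have hC : ∀ x ∈ Metric.closedBall (0 : E) R, ‖fderiv ℝ u x‖ ≤ C := fun x hx ↦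
    (hC₀ x hx).trans (Real.le_coe_toNNReal _)
  have hlip : LipschitzOnWith C u (Metric.closedBall 0 R) :=
    (convex_closedBall 0 R).lipschitzOnWith_of_nnnorm_hasFDerivWithin_le
      (fun x _ ↦ (hud x).hasFDerivWithinAt) fun x hx ↦ hC x hx
  have hdetcont : Continuous fun A : E →L[ℝ] E ↦ A.det := ContinuousLinearMap.continuous_det
  obtain ⟨δ, hδ, hdet⟩ : ∃ δ > 0, ∀ A : E →L[ℝ] E, ‖A‖ < δ → 0 < (1 + A).det := by
    have h1 : ∀ᶠ A : E →L[ℝ] E in nhds 0, 0 < (1 + A).det := by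
      refine (hdetcont.comp (continuous_const.add continuous_id)).continuousAt.eventually_const_lt ?_
      simp [ContinuousLinearMap.det]
    obtain ⟨δ, hδ, h⟩ := Metric.eventually_nhds_iff.1 h1
    exact ⟨δ, hδ, fun A hA ↦ h (by simpa using hA)⟩
  -- For `0 < t < ε`: `t < 1` and `t * C < 1` give the bijection of the ball, and `t * C < δ` makes
  -- the Jacobian positive.
  let ε := min 1 (min 1 δ / (C + 1))
  have hC1 : (0 : ℝ) < C + 1 := by positivity
  have hε : 0 < ε := lt_min one_pos (div_pos (lt_min one_pos hδ) hC1)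
  have hεC : ∀ t, 0 < t → t < ε → t * C < min 1 δ := by
    intro t ht h
    have := (lt_div_iff₀ hC1).1 (h.trans_le (min_le_right _ _))
    linarith
  have hintegrable : ∀ t : ℝ,
      IntegrableOn (fun x ↦ (1 + t • fderiv ℝ u x).det) (Metric.ball 0 R) μ := by
    intro t
    have : Continuous fun x ↦ (1 + t • fderiv ℝ u x).det :=
      hdetcont.comp (continuous_const.add (hu'.const_smul t))
    exact (this.continuousOn.integrableOn_compact (isCompact_closedBall 0 R)).mono_set
      Metric.ball_subset_closedBall
  have hvol : ∀ t, 0 < t → t < ε →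
      ∫ x in Metric.ball 0 R, (1 + t • fderiv ℝ u x).det ∂μ = μ.real (Metric.ball 0 R) := by
    intro t ht htε
    obtain ⟨hinj, himage⟩ := injOn_and_image_ball_eq_of_perturbation hR hlip
      (fun x hx ↦ by simp [u, hid x hx]) (fun x ↦ by simp [u, hnorm x]) ht
      (htε.trans_le (min_le_left _ _)) ((hεC t ht htε).trans_le (min_le_left _ _))
    have hderiv : ∀ x ∈ Metric.ball (0 : E) R,
        HasFDerivWithinAt (fun x ↦ x + t • u x) (1 + t • fderiv ℝ u x) (Metric.ball 0 R) x :=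
      fun x _ ↦ ((hasFDerivAt_id x).add ((hud x).const_smul t)).hasFDerivWithinAt
    have hcv := integral_image_eq_integral_abs_det_fderiv_smul μ measurableSet_ball hderiv hinj
      fun _ ↦ (1 : ℝ)
    rw [himage] at hcv
    simp only [smul_eq_mul, mul_one, setIntegral_const] at hcv
    rw [hcv]
    refine setIntegral_congr_fun measurableSet_ball fun x hx ↦ (abs_of_pos (hdet _ ?_)).symm
    rw [norm_smul, Real.norm_of_nonneg ht.le]
    exact (mul_le_mul_of_nonneg_left (hC x (Metric.ball_subset_closedBall hx)) ht.le).trans_lt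
      ((hεC t ht htε).trans_le (min_le_right _ _))
  obtain ⟨m, c, t, ht, hc, hsum⟩ := exists_det_one_add_eq_sum E hε
  have hzero : ∀ x, (1 + fderiv ℝ u x).det = 0 := fun x ↦ by
    refine det_fderiv_eq_zero_of_norm_eq hR (f := f) (x := x) ?_ hnorm
    have := (hasFDerivAt_id x).add (hud x)
    have hfu : f = id + u := by
      funext y
      simp [u]
    rw [hfu]
    exact this
  have hsum' : ∀ x, ∑ k, c k * (1 + t k • fderiv ℝ u x).det = 0 := fun x ↦
    (hsum (fderiv ℝ u x : E →ₗ[ℝ] E)).symm.trans (hzero x)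
  have hpos : 0 < μ.real (Metric.ball (0 : E) R) :=
    ENNReal.toReal_pos (Metric.measure_ball_pos μ 0 hR).ne' measure_ball_lt_top.ne
  -- The weights `c k` do not depend on `x`, so the extrapolation can be integrated: it gives `0`,
  -- but also `∑ c k = 1` times the volume.
  have h0 : ∫ x in Metric.ball 0 R, ∑ k, c k * (1 + t k • fderiv ℝ u x).det ∂μ = 0 := by
    simp [hsum']
  rw [integral_finsetSum _ fun k _ ↦ (hintegrable (t k)).const_mul (c k)] at h0
  simp only [integral_const_mul] at h0
  rw [Finset.sum_congr rfl fun k _ ↦ by rw [hvol (t k) (ht k).1 (ht k).2], ← Finset.sum_mul, hc,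
    one_mul] at h0
  exact hpos.ne' h0

/-! ### Brouwer's fixed point theorem -/

/-- A continuous bounded self-map of a Euclidean space has a fixed point. -/
theorem exists_fixedPoint_of_bounded {E : Type*} [NormedAddCommGroup E] [InnerProductSpace ℝ E]
    [FiniteDimensional ℝ E] {f : E → E} (hf : Continuous f) {r : ℝ} (hr : ∀ x, ‖f x‖ ≤ r) :
    ∃ x, f x = x := by
  by_contra! hne
  have hr0 : 0 ≤ r := (norm_nonneg _).trans (hr 0)
  -- The cutoff is `1` for `‖x‖ ≤ r` and `0` for `‖x‖ ≥ r + 1`. A fixed point of `φ • f` has norm at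
  -- most `r`, so it would be one of `f`.
  let φ : E → ℝ := fun x ↦ max 0 (min 1 (r + 1 - ‖x‖))
  have hφ : Continuous φ := by fun_prop
  have hφ0 : ∀ x, 0 ≤ φ x := fun x ↦ le_max_left _ _
  have hφ1 : ∀ x, φ x ≤ 1 := fun x ↦ max_le zero_le_one (min_le_left _ _)
  let h : E → E := fun x ↦ φ x • f x
  have hh : Continuous h := hφ.smul hf
  have hout : ∀ x, r + 1 ≤ ‖x‖ → h x = 0 := by
    intro x hx
    have : φ x = 0 := max_eq_left ((min_le_right _ _).trans (by linarith))
    simp [h, this]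
  have hnefix : ∀ x, h x - x ≠ 0 := by
    intro x hx
    rw [sub_eq_zero] at hx
    have h1 : ‖x‖ ≤ r := by
      rw [← hx, norm_smul, Real.norm_of_nonneg (hφ0 x)]
      nlinarith [hφ1 x, hφ0 x, hr x, norm_nonneg (f x)]
    have h2 : φ x = 1 := by
      simp only [φ]
      rw [min_eq_left (by linarith), max_eq_right zero_le_one]
    exact hne x (by simpa [h, h2] using hx)
  obtain ⟨x₀, -, hx₀⟩ := (isCompact_closedBall (0 : E) (r + 1)).exists_isMinOn
    ⟨0, by simpa using by linarith⟩ ((hh.sub continuous_id).norm.continuousOn)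
  have hδ : 0 < ‖h x₀ - x₀‖ := norm_pos_iff.2 (hnefix x₀)
  -- Approximating to within the least displacement of `h` on the ball creates no fixed point. As
  -- the support does not grow, `g = 0` on the sphere, so normalising `x - g x` fixes the sphere.
  obtain ⟨g, hg, hgdist, hgsupp⟩ := hh.exists_contDiff_approx 1 (ε := fun _ ↦ ‖h x₀ - x₀‖)
    continuous_const fun _ ↦ hδ
  have hgout : ∀ x, r + 1 ≤ ‖x‖ → g x = 0 := fun x hx ↦ by
    by_contra hgx
    exact hgsupp hgx (hout x hx)
  have hgne : ∀ x, x - g x ≠ 0 := by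
    intro x hx
    rw [sub_eq_zero] at hx
    rcases le_total (r + 1) ‖x‖ with hxr | hxr
    · have := hx.trans (hgout x hxr)
      rw [this, norm_zero] at hxr
      linarith
    · have h1 : ‖h x₀ - x₀‖ ≤ ‖h x - x‖ := hx₀ (by simpa using hxr)
      have h2 := hgdist x
      rw [← hx, dist_comm, dist_eq_norm] at h2
      linarith
  refine not_exists_contDiff_retraction_sphere (R := r + 1) (by linarith)
    (f := fun x ↦ ((r + 1) * ‖x - g x‖⁻¹) • (x - g x)) ?_ (fun x ↦ ?_) (fun x hx ↦ ?_)
  · have hd : ContDiff ℝ 1 fun x ↦ x - g x := contDiff_id.sub hg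
    exact (contDiff_const.mul ((hd.norm ℝ hgne).inv fun x ↦ norm_ne_zero_iff.2 (hgne x))).smul hd
  · rw [norm_smul, norm_mul, norm_inv, norm_norm, Real.norm_of_nonneg (by linarith), mul_assoc,
      inv_mul_cancel₀ (norm_ne_zero_iff.2 (hgne x)), mul_one]
  · rw [hgout x hx.ge, sub_zero, hx, mul_inv_cancel₀ (by linarith), one_smul]

/-- **Brouwer's fixed point theorem** for compact convex sets. -/
theorem exists_fixedPoint_of_isCompact_convex {V : Type*} [NormedAddCommGroup V] [NormedSpace ℝ V]
    [FiniteDimensional ℝ V] {K : Set V} (hne : K.Nonempty) (hK : IsCompact K)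
    (hconv : Convex ℝ K) {f : V → V} (hf : ContinuousOn f K) (hmaps : Set.MapsTo f K K) :
    ∃ x ∈ K, f x = x := by
  let e := toEuclidean (E := V)
  obtain ⟨P, hP, hPK, hPid, -⟩ := exists_lipschitzWith_one_retraction (K := e '' K)
    (hne.image e) (hK.image e.continuous).isComplete (hconv.linear_image e.toLinearEquiv.toLinearMap)
  have hPK' : ∀ x, e.symm (P x) ∈ K := fun x ↦ by
    obtain ⟨y, hy, hyx⟩ := hPK x
    rw [← hyx]
    simpa using hy
  obtain ⟨r, hr⟩ := (hK.image e.continuous).isBounded.exists_norm_le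
  -- Precomposing with the retraction extends the map to the whole space; its values, hence its
  -- fixed points, lie in `e '' K`.
  obtain ⟨x, hx⟩ := exists_fixedPoint_of_bounded (f := fun x ↦ e (f (e.symm (P x))))
    (e.continuous.comp (hf.comp_continuous (e.symm.continuous.comp hP.continuous) hPK'))
    (r := r) fun x ↦ hr _ ⟨_, hmaps (hPK' x), rfl⟩
  have hPx : P x = x := hPid x ⟨_, hmaps (hPK' x), hx⟩
  rw [hPx] at hx
  exact ⟨e.symm x, hPx ▸ hPK' x, e.injective (by simpa using hx)⟩

/-! ### Nash's theorem -/

namespace NormalFormGame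

variable {ι : Type*} {S : ι → Type*} [Fintype ι] [DecidableEq ι] [∀ i, Fintype (S i)]

/-- The extension of the expected payoff to a function of arbitrary families of weights. -/
def weightedPayoff (G : NormalFormGame ι S) (x : ∀ j, S j → ℝ) (i : ι) : ℝ :=
  ∑ s : (∀ j, S j), G.payoff s i * ∏ j, x j (s j)

theorem expectedPayoff_eq_weightedPayoff (G : NormalFormGame ι S) (σ : StrategyProfile ι S)
    (i : ι) : G.expectedPayoff σ i = G.weightedPayoff (fun j ↦ (σ j).1) i :=
  rfl

theorem continuous_weightedPayoff (G : NormalFormGame ι S) (i : ι) :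
    Continuous fun x ↦ G.weightedPayoff x i := by
  unfold weightedPayoff
  fun_prop

/-- Each product contains exactly one weight of player `i`, so the payoff is linear in her weights.
-/
theorem weightedPayoff_update (G : NormalFormGame ι S) [∀ i, DecidableEq (S i)]
    (x : ∀ j, S j → ℝ) (i : ι) (y : S i → ℝ) :
    G.weightedPayoff (Function.update x i y) i =
      ∑ a, y a * G.weightedPayoff (Function.update x i (Pi.single a 1)) i := by
  have hprod : ∀ (z : S i → ℝ) (s : ∀ j, S j), ∏ j, Function.update x i z j (s j) =
      z (s i) * ∏ j ∈ Finset.univ \ {i}, x j (s j) := by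
    intro z s
    rw [← Finset.prod_update_of_mem (Finset.mem_univ i)]
    refine Finset.prod_congr rfl fun j _ ↦ ?_
    rcases eq_or_ne j i with rfl | h
    · simp
    · simp [h]
  simp only [weightedPayoff, hprod, Finset.mul_sum]
  rw [Finset.sum_comm]
  refine Finset.sum_congr rfl fun s _ ↦ ?_
  rw [Finset.sum_eq_single (s i)]
  · simp
    ring
  · intro a _ ha
    simp [ha.symm]
  · simp

/-- What player `i` gains by deviating from `x` to the pure strategy `a`. -/
def deviationGain (G : NormalFormGame ι S) [∀ i, DecidableEq (S i)] (x : ∀ j, S j → ℝ) (i : ι)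
    (a : S i) : ℝ :=
  G.weightedPayoff (Function.update x i (Pi.single a 1)) i - G.weightedPayoff x i

theorem continuous_deviationGain (G : NormalFormGame ι S) [∀ i, DecidableEq (S i)] (i : ι)
    (a : S i) : Continuous fun x ↦ G.deviationGain x i a :=
  ((G.continuous_weightedPayoff i).comp (continuous_id.update i continuous_const)).sub
    (G.continuous_weightedPayoff i)

/-- With `y = x i` the average gain is zero; with general `y` this reduces mixed deviations to pure
ones. -/
theorem sum_mul_deviationGain (G : NormalFormGame ι S) [∀ i, DecidableEq (S i)]
    (x : ∀ j, S j → ℝ) (i : ι) {y : S i → ℝ} (hy : ∑ a, y a = 1) :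
    ∑ a, y a * G.deviationGain x i a =
      G.weightedPayoff (Function.update x i y) i - G.weightedPayoff x i := by
  simp only [deviationGain, mul_sub, Finset.sum_sub_distrib, ← G.weightedPayoff_update,
    ← Finset.sum_mul, hy, one_mul]

/-- The self-map of the set of mixed strategy profiles whose fixed points are the Nash
equilibria. -/
noncomputable def nashMap (G : NormalFormGame ι S) [∀ i, DecidableEq (S i)] (x : ∀ j, S j → ℝ) :
    ∀ j, S j → ℝ :=
  fun i a ↦ (x i a + max 0 (G.deviationGain x i a)) / (1 + ∑ b, max 0 (G.deviationGain x i b))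

theorem one_add_sum_max_deviationGain_pos (G : NormalFormGame ι S) [∀ i, DecidableEq (S i)]
    (x : ∀ j, S j → ℝ) (i : ι) : 0 < 1 + ∑ b, max 0 (G.deviationGain x i b) :=
  add_pos_of_pos_of_nonneg one_pos (Finset.sum_nonneg fun _ _ ↦ le_max_left _ _)

theorem continuous_nashMap (G : NormalFormGame ι S) [∀ i, DecidableEq (S i)] :
    Continuous G.nashMap := by
  have hmax : ∀ i a, Continuous fun x ↦ max 0 (G.deviationGain x i a) := fun i a ↦
    continuous_const.max (G.continuous_deviationGain i a)
  refine continuous_pi fun i ↦ continuous_pi fun a ↦ Continuous.div ?_ ?_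
    fun x ↦ (G.one_add_sum_max_deviationGain_pos x i).ne'
  · have hx : Continuous fun x : ∀ j, S j → ℝ ↦ x i a := by fun_prop
    exact hx.add (hmax i a)
  · exact continuous_const.add (continuous_finsetSum _ fun b _ ↦ hmax i b)

theorem nashMap_mem_stdSimplex (G : NormalFormGame ι S) [∀ i, DecidableEq (S i)]
    {x : ∀ j, S j → ℝ} {i : ι} (hx : x i ∈ stdSimplex ℝ (S i)) :
    G.nashMap x i ∈ stdSimplex ℝ (S i) := by
  have hpos := G.one_add_sum_max_deviationGain_pos x i
  refine ⟨fun a ↦ div_nonneg (add_nonneg (hx.1 a) (le_max_left _ _)) hpos.le, ?_⟩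
  simp only [nashMap]
  rw [← Finset.sum_div, Finset.sum_add_distrib, hx.2, div_self hpos.ne']

/-- At a fixed point the positive part of each gain `d b` is `x i b` times the sum of all positive
parts. Multiplying by `d b` and summing, the squared positive parts add up to a multiple of the
average gain, which is zero. -/
theorem deviationGain_nonpos_of_nashMap_eq (G : NormalFormGame ι S) [∀ i, DecidableEq (S i)]
    {x : ∀ j, S j → ℝ} {i : ι} (hx : x i ∈ stdSimplex ℝ (S i)) (hfix : G.nashMap x = x)
    (a : S i) : G.deviationGain x i a ≤ 0 := by
  set d := G.deviationGain x i with hd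
  have hpos := G.one_add_sum_max_deviationGain_pos x i
  have h1 : ∀ b, x i b * ∑ c, max 0 (d c) = max 0 (d b) := by
    intro b
    have h := congrFun (congrFun hfix i) b
    rw [nashMap, div_eq_iff hpos.ne'] at h
    linarith
  have h2 : ∑ b, x i b * d b = 0 := by
    rw [hd, G.sum_mul_deviationGain x i hx.2, Function.update_eq_self, sub_self]
  have h3 : ∑ b, max 0 (d b) * max 0 (d b) = 0 := by
    have : ∀ b, max 0 (d b) * max 0 (d b) = (∑ c, max 0 (d c)) * (x i b * d b) := by
      intro b
      rw [← mul_assoc, mul_comm _ (x i b), h1 b]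
      rcases le_total (d b) 0 with h | h
      · simp [max_eq_left h]
      · simp [max_eq_right h]
    rw [Finset.sum_congr rfl fun b _ ↦ this b, ← Finset.mul_sum, h2, mul_zero]
  have h4 := (Finset.sum_eq_zero_iff_of_nonneg fun b _ ↦ mul_self_nonneg _).1 h3 a
    (Finset.mem_univ a)
  exact max_eq_left_iff.1 (mul_self_eq_zero.1 h4)

/-- **Nash's theorem**: every finite game has a mixed Nash equilibrium. -/
theorem nashEquilibria_nonempty [∀ i, Nonempty (S i)] (G : NormalFormGame ι S) :
    G.nashEquilibria.Nonempty := by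
  classical
  obtain ⟨x, hx, hfix⟩ := exists_fixedPoint_of_isCompact_convex
    (K := Set.univ.pi fun i ↦ stdSimplex ℝ (S i))
    (Set.univ_pi_nonempty_iff.2 fun i ↦
      ⟨_, single_mem_stdSimplex ℝ (Classical.arbitrary (S i))⟩)
    (isCompact_univ_pi fun i ↦ isCompact_stdSimplex ℝ (S i))
    (convex_pi fun i _ ↦ convex_stdSimplex ℝ (S i)) G.continuous_nashMap.continuousOn
    fun x hx i hi ↦ G.nashMap_mem_stdSimplex (hx i hi)
  refine ⟨fun i ↦ ⟨x i, hx i (Set.mem_univ i)⟩, fun i τ ↦ ?_⟩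
  have hgain : ∑ a, τ.1 a * G.deviationGain x i a ≤ 0 :=
    Finset.sum_nonpos fun a _ ↦ mul_nonpos_of_nonneg_of_nonpos (τ.2.1 a)
      (G.deviationGain_nonpos_of_nashMap_eq (hx i (Set.mem_univ i)) hfix a)
  rw [G.sum_mul_deviationGain x i τ.2.2, sub_nonpos] at hgain
  rw [expectedPayoff_eq_weightedPayoff, expectedPayoff_eq_weightedPayoff]
  convert hgain using 2
  funext j
  rcases eq_or_ne j i with rfl | h
  · simp
  · simp [h]

end NormalFormGame

/-! ### Termination of the Adaptation Procedure -/

theorem characteristicSet_nonempty {ι : Type*} {S : ι → Type*} [∀ i, Fintype (S i)]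
    (σ : StrategyProfile ι S) : (characteristicSet σ).Nonempty := by
  have h : ∀ i, ∃ a, 0 < σ i a := by
    intro i
    obtain ⟨a, -, ha⟩ := Finset.exists_lt_of_sum_lt (s := Finset.univ) (f := fun _ : S i ↦ (0 : ℝ))
      (g := (σ i).1) (by rw [(σ i).2.2]; simp)
    exact ⟨a, ha⟩
  choose v hv using h
  exact ⟨v, hv⟩

namespace MisinformationGame

variable {ι : Type*} {S : ι → Type*} [Fintype ι]

theorem NME_nonempty [DecidableEq ι] [∀ i, Fintype (S i)] [∀ i, Nonempty (S i)]
    (mG : MisinformationGame ι S) : mG.NME.Nonempty := by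
  choose τ hτ using fun i ↦ (mG.subjective i).nashEquilibria_nonempty
  exact ⟨fun i ↦ τ i i, fun i ↦ ⟨τ i, hτ i, rfl⟩⟩

/-- The positions at which some player is misinformed. -/
def misinformedPositions {ι : Type*} {S : ι → Type*} (mG : MisinformationGame ι S) :
    Set (∀ i, S i) :=
  {v | ∃ i, (mG.subjective i).payoff v ≠ mG.actual.payoff v}

theorem misinformedPositions_updateAt [∀ i, DecidableEq (S i)] (mG : MisinformationGame ι S)
    (v : ∀ i, S i) :
    (mG.updateAt v).misinformedPositions = mG.misinformedPositions \ {v} := by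
  ext w
  by_cases h : w = v
  · subst h
    simp [misinformedPositions, updateAt]
  · simp [misinformedPositions, updateAt, h]

theorem updateAt_eq_self [∀ i, DecidableEq (S i)] {mG : MisinformationGame ι S} {v : ∀ i, S i}
    (hv : v ∉ mG.misinformedPositions) : mG.updateAt v = mG := by
  simp only [misinformedPositions, Set.mem_ofPred_eq, not_exists, not_not] at hv
  refine MisinformationGame.ext rfl (funext fun i ↦ NormalFormGame.ext ?_)
  simp only [updateAt]
  rw [← hv i, Function.update_eq_self]

variable [∀ i, Fintype (S i)] [∀ i, DecidableEq (S i)]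

/-- This count is the potential behind both termination and acyclicity. -/
theorem ncard_misinformedPositions_updateAt_lt {mG : MisinformationGame ι S} {v : ∀ i, S i}
    (h : mG.updateAt v ≠ mG) :
    (mG.updateAt v).misinformedPositions.ncard < mG.misinformedPositions.ncard := by
  rw [misinformedPositions_updateAt]
  exact Set.ncard_sdiff_singleton_lt_of_mem (not_not.1 (mt updateAt_eq_self h)) (Set.toFinite _)

variable [DecidableEq ι]

theorem adapt_mono : Monotone (adapt : Set (MisinformationGame ι S) → _) :=
  fun _ _ h _ ⟨m, hm, hm'⟩ ↦ ⟨m, h hm, hm'⟩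

/-- Each game evolves independently of the others, so the termination argument may split a set of
games. -/
theorem iterate_adapt_union (t : ℕ) (M N : Set (MisinformationGame ι S)) :
    adapt^[t] (M ∪ N) = adapt^[t] M ∪ adapt^[t] N := by
  induction t generalizing M N with
  | zero => rfl
  | succ t ih =>
    have : adapt (M ∪ N) = adapt M ∪ adapt N := by
      ext m
      simp only [adapt, Set.mem_ofPred_eq, Set.mem_union, or_and_right, exists_or]
    rw [Function.iterate_succ_apply, this, ih]
    rfl

/-- The Adaptation Procedure is stationary from the step on at which every misinformed position
can have been corrected. -/
theorem iterate_adapt_succ_eq [∀ i, Nonempty (S i)] (t : ℕ) (M : Set (MisinformationGame ι S))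
    (hM : ∀ m ∈ M, m.misinformedPositions.ncard ≤ t) : adapt^[t + 1] M = adapt^[t] M := by
  induction t generalizing M with
  | zero =>
    have hself : ∀ m ∈ M, ∀ v, m.updateAt v = m := fun m hm v ↦ by
      by_contra h
      have := ncard_misinformedPositions_updateAt_lt h
      have := hM m hm
      omega
    refine Set.Subset.antisymm ?_ fun m hm ↦ ?_
    · rintro _ ⟨m, hm, σ, -, v, -, rfl⟩
      rw [hself m hm v]
      exact hm
    · obtain ⟨σ, hσ⟩ := m.NME_nonempty
      obtain ⟨v, hv⟩ := characteristicSet_nonempty σ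
      exact ⟨m, hm, σ, hσ, v, hv, (hself m hm v).symm⟩
  | succ t ih =>
    -- Games in `L` still have `t + 1` misinformed positions, so no proper update produced them:
    -- they carry loops. The induction hypothesis covers `R`.
    let L := {m ∈ adapt M | ¬ m.misinformedPositions.ncard ≤ t}
    let R := {m ∈ adapt M | m.misinformedPositions.ncard ≤ t}
    have hLR : adapt M = L ∪ R := by
      ext m
      by_cases h : m.misinformedPositions.ncard ≤ t
      · simp [L, R, h]
      · simp [L, R, h, not_le.1 h]
    have hloop : ∀ m ∈ L, m ∈ M ∧ m ∈ adapt {m} := by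
      rintro _ ⟨⟨m, hm, σ, hσ, v, hv, rfl⟩, hlt⟩
      have heq : m.updateAt v = m := by
        by_contra h
        have := ncard_misinformedPositions_updateAt_lt h
        have := hM m hm
        omega
      rw [heq]
      exact ⟨hm, m, rfl, σ, hσ, v, hv, heq.symm⟩
    have hLM : L ⊆ M := fun m hm ↦ (hloop m hm).1
    have hLL : L ⊆ adapt L := fun m hm ↦
      adapt_mono (Set.singleton_subset_iff.2 hm) (hloop m hm).2
    have hR : adapt^[t + 1] R = adapt^[t] R := ih R fun m hm ↦ hm.2
    have h1 : adapt^[t + 1] M = adapt^[t] L ∪ adapt^[t] R := by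
      rw [Function.iterate_succ_apply, hLR, iterate_adapt_union]
    have h2 : adapt^[t + 1 + 1] M = adapt^[t + 1] L ∪ adapt^[t] R := by
      rw [Function.iterate_succ_apply, hLR, iterate_adapt_union, hR]
    -- One inclusion uses `L ⊆ M`, the other `L ⊆ adapt L`.
    refine Set.Subset.antisymm ?_ ?_
    · rw [h2]
      refine Set.union_subset (adapt_mono.iterate (t + 1) hLM) ?_
      rw [h1]
      exact Set.subset_union_right
    · rw [h1, h2]
      refine Set.union_subset_union_left _ ?_
      rw [Function.iterate_succ_apply]
      exact adapt_mono.iterate t hLL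

theorem exists_terminatesAt [∀ i, Nonempty (S i)] (mG : MisinformationGame ι S) :
    ∃ t, TerminatesAt {mG} t := by
  have hne : {t : ℕ | adapt^[t + 1] {mG} = adapt^[t] {mG}}.Nonempty :=
    ⟨_, iterate_adapt_succ_eq mG.misinformedPositions.ncard {mG} (by simp)⟩
  exact ⟨_, Nat.sInf_mem hne, fun t ht ↦ Nat.sInf_le ht⟩

theorem TerminatesAt.iterate_adapt_add {M : Set (MisinformationGame ι S)} {t : ℕ}
    (h : TerminatesAt M t) (k : ℕ) : adapt^[t + k] M = adapt^[t] M := by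
  induction k with
  | zero => rfl
  | succ k ih =>
    have h1 : adapt^[t + 1] M = adapt^[t] M := h.1
    rw [Function.iterate_succ_apply'] at h1
    rw [← add_assoc, Function.iterate_succ_apply', ih, h1]

/-- A loop keeps `mG'` in every iterate from its first appearance `s` on. If the procedure
terminates at `t`, iterate `t + s` contains `mG'` and equals iterate `t`. -/
theorem mem_stableSet_of_mem_adapt_singleton [∀ i, Nonempty (S i)]
    {mG mG' : MisinformationGame ι S} (h : mG' ∈ adaptStar {mG}) (hloop : mG' ∈ adapt {mG'}) :
    mG' ∈ stableSet {mG} := by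
  obtain ⟨s, hs⟩ := Set.mem_iUnion.1 h
  obtain ⟨t, ht⟩ := mG.exists_terminatesAt
  have hmem : ∀ k, mG' ∈ adapt^[s + k] {mG} := by
    intro k
    induction k with
    | zero => exact hs
    | succ k ih =>
      rw [← add_assoc, Function.iterate_succ_apply']
      exact adapt_mono (Set.singleton_subset_iff.2 ih) hloop
  refine ⟨t, ht, ?_⟩
  rw [← ht.iterate_adapt_add s, add_comm]
  exact hmem t

theorem updateAt_mem_adaptStar {M : Set (MisinformationGame ι S)} {mG : MisinformationGame ι S}
    (h : mG ∈ adaptStar M) {σ : StrategyProfile ι S} (hσ : σ ∈ mG.NME) {v : ∀ i, S i}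
    (hv : v ∈ characteristicSet σ) : mG.updateAt v ∈ adaptStar M := by
  obtain ⟨t, ht⟩ := Set.mem_iUnion.1 h
  refine Set.mem_iUnion.2 ⟨t + 1, ?_⟩
  rw [Function.iterate_succ_apply']
  exact ⟨mG, ht, σ, hσ, v, hv, rfl⟩

/-! ### Sinks and maximal paths -/

theorem updateAt_eq_self_of_mem_sinks {mG mG' : MisinformationGame ι S} (h : mG' ∈ mG.sinks)
    {σ : StrategyProfile ι S} (hσ : σ ∈ mG'.NME) {v : ∀ i, S i} (hv : v ∈ characteristicSet σ) :
    mG'.updateAt v = mG' := by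
  obtain ⟨hmem, hdeg⟩ := h
  by_contra hne
  have hadj : mG.looplessAdaptationGraph.Adj ⟨mG', hmem⟩
      ⟨mG'.updateAt v, updateAt_mem_adaptStar hmem hσ hv⟩ :=
    ⟨⟨σ, hσ, v, hv, rfl⟩, fun e ↦ hne (congrArg Subtype.val e).symm⟩
  rw [Digraph.outDeg, Set.encard_eq_zero] at hdeg
  exact Set.eq_empty_iff_forall_notMem.1 hdeg _ hadj

/-- Nash's theorem is essential: without an nme, a sink would have no loop either. -/
theorem sinks_subset_terminalSet [∀ i, Nonempty (S i)] (mG : MisinformationGame ι S) :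
    mG.sinks ⊆ mG.terminalSet := by
  intro mG' h
  obtain ⟨σ, hσ⟩ := mG'.NME_nonempty
  obtain ⟨v, hv⟩ := characteristicSet_nonempty σ
  exact ⟨h.1, mG', rfl, σ, hσ, v, hv, (updateAt_eq_self_of_mem_sinks h hσ hv).symm⟩

theorem NME_subset_SME_of_mem_sinks [∀ i, Nonempty (S i)] {mG mG' : MisinformationGame ι S}
    (h : mG' ∈ mG.sinks) : mG'.NME ⊆ mG.SME := by
  have hterm := mG.sinks_subset_terminalSet h
  exact fun σ hσ ↦ ⟨mG', mem_stableSet_of_mem_adapt_singleton hterm.1 hterm.2, hσ,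
    fun v hv ↦ updateAt_eq_self_of_mem_sinks h hσ hv⟩

theorem ncard_misinformedPositions_lt_of_adj {mG : MisinformationGame ι S}
    {a b : adaptStar {mG}} (h : mG.looplessAdaptationGraph.Adj a b) :
    b.1.misinformedPositions.ncard < a.1.misinformedPositions.ncard := by
  obtain ⟨⟨σ, -, v, -, hb⟩, hne⟩ := h
  rw [hb]
  refine ncard_misinformedPositions_updateAt_lt fun e ↦ hne (Subtype.ext ?_)
  rw [hb, e]

/-- The loopless adaptation graph has no cycles. -/
theorem nodup_of_isChain {mG : MisinformationGame ι S} {p : List (adaptStar {mG})}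
    (h : p.IsChain mG.looplessAdaptationGraph.Adj) : p.Nodup := by
  have hlt : p.IsChain fun a b ↦
      b.1.misinformedPositions.ncard < a.1.misinformedPositions.ncard :=
    h.imp fun _ _ ↦ ncard_misinformedPositions_lt_of_adj
  have : IsTrans (adaptStar {mG}) fun a b ↦
      b.1.misinformedPositions.ncard < a.1.misinformedPositions.ncard :=
    ⟨fun _ _ _ hab hbc ↦ hbc.trans hab⟩
  refine (List.isChain_iff_pairwise.1 hlt).imp ?_
  rintro a _ hab rfl
  exact lt_irrefl _ hab

/-- An out-neighbour of the last vertex could be appended: acyclicity guarantees that it is not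
already on the path. -/
theorem getLast_mem_sinks {mG : MisinformationGame ι S} {p : List (adaptStar {mG})}
    {mG' : adaptStar {mG}} (hp : mG.looplessAdaptationGraph.IsMaximalPathFrom mG.root p)
    (hlast : p.getLast? = some mG') : mG'.1 ∈ mG.sinks := by
  refine ⟨mG'.2, ?_⟩
  rw [Digraph.outDeg, Set.encard_eq_zero, Set.eq_empty_iff_forall_notMem]
  intro b hb
  obtain ⟨⟨hhead, hchain, -⟩, hmax⟩ := hp
  have hchain' : (p ++ [b]).IsChain mG.looplessAdaptationGraph.Adj := by
    refine List.isChain_append.2 ⟨hchain, List.isChain_singleton b, fun x hx y hy ↦ ?_⟩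
    rw [hlast] at hx
    simp only [Option.mem_def, Option.some.injEq, List.head?_cons] at hx hy
    exact hx ▸ hy ▸ hb
  have := hmax (p ++ [b]) ⟨by simp [List.head?_append, hhead], hchain', nodup_of_isChain hchain'⟩
    (List.prefix_append p [b])
  simp at this

end MisinformationGame

theorem mainTheorem10 {ι : Type*} {S : ι → Type*} [Fintype ι] [DecidableEq ι]
    [∀ i, Fintype (S i)] [∀ i, DecidableEq (S i)] [∀ i, Nonempty (S i)]
    (mG : MisinformationGame ι S) :
    mG.sinks ⊆ mG.terminalSet ∧
    (∀ mG' ∈ mG.sinks, mG'.NME ⊆ mG.SME) ∧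
    (∀ (p : List (MisinformationGame.adaptStar {mG})) (mG' : MisinformationGame.adaptStar {mG}),
      mG.looplessAdaptationGraph.IsMaximalPathFrom mG.root p → p.getLast? = some mG' →
        mG'.1.NME.Nonempty ∧ mG'.1.NME ⊆ mG.SME) :=
  ⟨mG.sinks_subset_terminalSet,
    fun _ h ↦ MisinformationGame.NME_subset_SME_of_mem_sinks h,
    fun _ mG' hp hlast ↦ ⟨mG'.1.NME_nonempty,
      MisinformationGame.NME_subset_SME_of_mem_sinks
        (MisinformationGame.getLast_mem_sinks hp hlast)⟩⟩
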